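/- Let $n\ge 1$ and $k\ge 2$ be integers with $k\mid n$, and let $\mathcal J=\{J\subseteq\{1,\dots,n\}:|J|=k\}$. Let $\mathbb S^{(n,k)}$ be the space of families $\mathcal Y=(Y_J)_{J\in\mathcal J}$ of real symmetric $k\times k$ matrices, with inner product $\langle\mathcal X,\mathcal Y\rangle=\sum_{J}\operatorname{tr}(X_JY_J)$, and let $\mathbb S_+^{(n,k)}$ be the cone of those families in which every $Y_J$ is positive semidefinite. For $J=\{i_1<\dots<i_k\}$ let $Y_J^{\to n}$ be the $n\times n$ matrix whose $(i_a,i_b)$ entry is $(Y_J)_{a,b}$ and whose other entries are $0$, and put $\Psi(\mathcal Y)=\sum_{J\in\mathcal J}Y_J^{\to n}$. A functional $f$ on an open convex set $D$ of a finite-dimensional Euclidean space, twice continuously differentiable with gradient $g(x)$ and positive definite Hessian $H(x)$ at each $x\in D$, is called a *self-concordant barrier* on $D$ if, with $\|v\|_x:=\langle v,H(x)v\rangle^{1/2}$, (i) for every $x\in D$, every $y$ with $\|y-x\|_x<1$ lies in $D$ and satisfies $$1-\|y-x\|_x\le\frac{\|v\|_y}{\|v\|_x}\le\frac1{1-\|y-x\|_x}\quad\text{for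 all }v\neq0;$$ (ii) $\sup_{x\in D}\|H(x)^{-1}g(x)\|_x^2<\infty$. Then $$f^{\mathrm{FW}(k)}(\mathcal Y)=-\sum_{J\in\mathcal J}\log\det Y_J$$ is a self-concordant barrier on $\operatorname{int}\mathbb S_+^{(n,k)}$. Furthermore, if $\mathcal Y\in\operatorname{int}\mathbb S_+^{(n,k)}$ and $X=\Psi(\mathcal Y)$, then $$f^{\mathrm{FW}(k)}(\mathcal Y)\ \ge\ -\binom{n-1}{k-1}\log\det X+n\binom{n-1}{k-1}\log\binom{n-1}{k-1}.$$ -/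

import Mathlib

noncomputable section

namespace FactorWidth

section SelfConcordance

variable {E : Type*} [NormedAddCommGroup E] [InnerProductSpace ℝ E] [CompleteSpace E]

/-- The Hessian `H(x)` of `f` at `x` with respect to the reference inner product of `E`:
the derivative at `x` of the gradient of `f`, as a linear operator on `E`. -/
def hessian (f : E → ℝ) (x : E) : E →L[ℝ] E :=
  fderiv ℝ (gradient f) x

/-- The local inner product `⟨u, v⟩_x = ⟨u, H(x) v⟩`. -/
def localInner (f : E → ℝ) (x u v : E) : ℝ :=
  inner ℝ u (hessian f x v)

/-- The local norm `‖v‖_x = √⟨v, v⟩_x`. -/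
def localNorm (f : E → ℝ) (x v : E) : ℝ :=
  Real.sqrt (localInner f x v v)

/-- The open ball `B_x(y, r)` with centre `y` and radius `r` in the local norm at `x`. -/
def localBall (f : E → ℝ) (x y : E) (r : ℝ) : Set E :=
  {z | localNorm f x (z - y) < r}

/-- `f` with domain `D` is (strongly non-degenerate) self-concordant: `D` is open and convex,
`f` is twice continuously differentiable on `D` with positive definite Hessian, and for every
`x ∈ D` the unit ball `B_x(x, 1)` lies in `D` and the local norms at its points `y` satisfy
`1 - ‖y - x‖_x ≤ ‖v‖_y / ‖v‖_x ≤ 1 / (1 - ‖y - x‖_x)` for all `v ≠ 0`. -/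
structure IsSelfConcordant [FiniteDimensional ℝ E] (f : E → ℝ) (D : Set E) : Prop where
  isOpen : IsOpen D
  convex : Convex ℝ D
  contDiffOn : ContDiffOn ℝ 2 f D
  hessian_pos : ∀ x ∈ D, ∀ v : E, v ≠ 0 → 0 < localInner f x v v
  ball_subset : ∀ x ∈ D, localBall f x x 1 ⊆ D
  norm_ratio : ∀ x ∈ D, ∀ y ∈ localBall f x x 1, ∀ v : E, v ≠ 0 →
    1 - localNorm f x (y - x) ≤ localNorm f y v / localNorm f x v ∧
      localNorm f y v / localNorm f x v ≤ 1 / (1 - localNorm f x (y - x))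

/-- `f` with domain `D` is a self-concordant barrier functional: it is self-concordant and
`ϑ_f = sup_{x ∈ D} ‖H(x)⁻¹ g(x)‖_x ^ 2` is finite, where `g` is the gradient of `f`. The
operator `H(x)` is invertible for `x ∈ D`, being positive definite in finite dimension. -/
structure IsSelfConcordantBarrier [FiniteDimensional ℝ E] (f : E → ℝ) (D : Set E) : Prop
    extends IsSelfConcordant f D where
  complexity_finite :
    BddAbove ((fun x => localNorm f x ((hessian f x).inverse (gradient f x)) ^ 2) '' D)

end SelfConcordance

/-- The `k`-element subsets `J` of `[n]`. -/
abbrev KSubset (n k : ℕ) : Type :=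
  {J : Finset (Fin n) // J.card = k}

/-- The space of families `(Y_J)` of symmetric real `k × k` matrices, one for each `k`-element
subset `J` of `[n]`. The entry `(Y_J)_{a b}` is the coordinate `(J, a, b)`; the inner product is
the one inherited from Euclidean space, that is `∑_J ∑_{a, b} (X_J)_{a b} (Y_J)_{a b}`, which is
`∑_J tr (X_J Y_J)`. -/
def symFamilies (n k : ℕ) : Submodule ℝ (EuclideanSpace ℝ (KSubset n k × Fin k × Fin k)) where
  carrier := {y | ∀ J a b, y (J, a, b) = y (J, b, a)}
  add_mem' := by
    intro x y hx hy J a b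
    simp [hx J a b, hy J a b]
  zero_mem' := by
    intro J a b
    simp
  smul_mem' := by
    intro c x hx J a b
    simp [hx J a b]

variable {n k : ℕ}

/-- The matrix `Y_J` of the family `Y`. -/
def block (Y : symFamilies n k) (J : KSubset n k) : Matrix (Fin k) (Fin k) ℝ :=
  Matrix.of fun a b => Y.1 (J, a, b)

/-- The product of positive semidefinite cones: all `Y_J` are positive semidefinite. -/
def psdFamilies (n k : ℕ) : Set (symFamilies n k) :=
  {Y | ∀ J, (block Y J).PosSemidef}

/-- For `J = {i_1 < ⋯ < i_k}` and a `k × k` matrix `S`, the `n × n` matrix whose `(i_a, i_b)`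
entry is `S_{a b}` and whose entries outside `J × J` are zero. -/
def extendByZero (J : KSubset n k) (S : Matrix (Fin k) (Fin k) ℝ) : Matrix (Fin n) (Fin n) ℝ :=
  Matrix.of fun i j =>
    if h : i ∈ J.1 ∧ j ∈ J.1 then
      S ((J.1.orderIsoOfFin J.2).symm ⟨i, h.1⟩) ((J.1.orderIsoOfFin J.2).symm ⟨j, h.2⟩)
    else 0

/-- The operator `Ψ(Y) = ∑_J Y_J^{→ n}`. -/
def Psi (Y : symFamilies n k) : Matrix (Fin n) (Fin n) ℝ :=
  ∑ J : KSubset n k, extendByZero J (block Y J)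

/-- `f(Y) = -∑_J log det Y_J`. -/
def fFW (Y : symFamilies n k) : ℝ :=
  -∑ J : KSubset n k, Real.log (block Y J).det

/-- `f(X) = -log det X`. -/
def fSDP (X : Matrix (Fin n) (Fin n) ℝ) : ℝ :=
  -Real.log X.det

end FactorWidth

end

/-! Both halves rest on writing a positive definite `Y` and a symmetric `Z` as `Q Qᵀ` and `Q diag(d)
Qᵀ` with a common invertible `Q`.

Barrier: the Hessian form of `-log det` at `Y` is `tr (Y⁻¹ V Y⁻¹ V)`. With `u = Q⁻¹ V Q⁻ᵀ` it equals
`∑ u_ij²` at `Y` and `∑ u_ij² / (d_i d_j)` at `Z`, while `‖Z - Y‖_Y² = ∑ (d_i - 1)²`. Local distance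
at most `t < 1` thus forces `|d_i - 1| ≤ t`, which gives both `Z ≻ 0` and the norm ratios
(`posDef_and_logDetForm_bounds`). The complexity is finite because `H(Y)⁻¹ g(Y) = -Y`, whose squared
local norm is constant.

Inequality: this is Jensen for `log det`. Put `C = (n-1).choose (k-1)`. A partition of `[n]` into
`k`-sets turns the corresponding `Y_J` into one block diagonal matrix, and averaging these matrices
over all partitions gives `A = C⁻¹ • X`. The tangent inequality at `A` (`log_det_le`), applied to
each partition (`sum_partBlock_le`) and averaged (`sum_le_choose_mul`), yields `∑_J log det Y_J ≤ C
log det A`. -/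

namespace FactorWidth

/-! ### The second-order form and the concavity of `log det` on one matrix. -/

section Matrices

open Matrix

variable {ι : Type*} [Fintype ι] [DecidableEq ι]

/-- A positive definite matrix and a symmetric matrix are simultaneously diagonalized by a
congruence. -/
theorem exists_congruence_diagonal {Y Z : Matrix ι ι ℝ} (hY : Y.PosDef) (hZ : Z.IsHermitian) :
    ∃ (Q : Matrix ι ι ℝ) (d : ι → ℝ), IsUnit Q ∧ Y = Q * Qᵀ ∧ Z = Q * diagonal d * Qᵀ := by
  obtain ⟨B, hB, hYB⟩ : ∃ B : Matrix ι ι ℝ, IsUnit B ∧ Y = B * Bᵀ := by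
    have hs := hY.1.spectral_theorem
    set U : Matrix ι ι ℝ := (hY.1.eigenvectorUnitary : Matrix ι ι ℝ) with hU
    have hUu : IsUnit U := (Unitary.toUnits hY.1.eigenvectorUnitary).isUnit
    set r : ι → ℝ := fun i => √(hY.1.eigenvalues i) with hr
    refine ⟨U * diagonal r, hUu.mul ?_, ?_⟩
    · rw [isUnit_iff_isUnit_det, det_diagonal, isUnit_iff_ne_zero]
      exact Finset.prod_ne_zero_iff.2 fun i _ => (Real.sqrt_pos.2 (hY.eigenvalues_pos i)).ne'
    · conv_lhs => rw [hs]
      rw [Unitary.conjStarAlgAut_apply, transpose_mul, diagonal_transpose, ← hU, Matrix.mul_assoc,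
        Matrix.mul_assoc, ← Matrix.mul_assoc (diagonal r), diagonal_mul_diagonal]
      have : (fun i => r i * r i) = RCLike.ofReal ∘ hY.1.eigenvalues := by
        funext i
        simp [hr, Real.mul_self_sqrt (hY.eigenvalues_pos i).le]
      rw [this]
      rfl
  have hdet : IsUnit B.det := (isUnit_iff_isUnit_det B).1 hB
  -- In coordinates where `Y` is the identity, an orthogonal `U` diagonalizes `Z` without disturbing
  -- `B * Bᵀ`.
  have hW : (B⁻¹ * Z * (B⁻¹)ᵀ).IsHermitian := by
    have := isHermitian_mul_mul_conjTranspose B⁻¹ hZ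
    rwa [conjTranspose_eq_transpose_of_trivial] at this
  have hs := hW.spectral_theorem
  set U : Matrix ι ι ℝ := (hW.eigenvectorUnitary : Matrix ι ι ℝ) with hU
  have hUu : IsUnit U := (Unitary.toUnits hW.eigenvectorUnitary).isUnit
  have hUU : U * Uᵀ = 1 := Unitary.coe_mul_star_self hW.eigenvectorUnitary
  refine ⟨B * U, hW.eigenvalues, hB.mul hUu, ?_, ?_⟩
  · rw [transpose_mul, Matrix.mul_assoc, ← Matrix.mul_assoc U, hUU, Matrix.one_mul, hYB]
  · have h2 : U * diagonal hW.eigenvalues * Uᵀ = B⁻¹ * Z * (B⁻¹)ᵀ := by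
      conv_rhs => rw [hs]
      rw [Unitary.conjStarAlgAut_apply]
      rfl
    calc Z = B * (B⁻¹ * Z * (B⁻¹)ᵀ) * Bᵀ := by
          rw [transpose_nonsing_inv, Matrix.mul_assoc B⁻¹, mul_nonsing_inv_cancel_left _ _ hdet,
            nonsing_inv_mul_cancel_right _ _ (by rwa [det_transpose])]
      _ = _ := by
          refine (congrArg (fun M => B * M * Bᵀ) h2.symm).trans ?_
          simp only [transpose_mul, Matrix.mul_assoc]

/-- The second derivative `tr (Y⁻¹ V Y⁻¹ V)` of `-log det` at `Y` in the direction `V`. -/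
noncomputable def logDetForm (Y V : Matrix ι ι ℝ) : ℝ :=
  (Y⁻¹ * V * Y⁻¹ * V).trace

theorem inv_congruence_diagonal {Q : Matrix ι ι ℝ} {d : ι → ℝ} (hd : ∀ i, d i ≠ 0) :
    (Q * diagonal d * Qᵀ)⁻¹ = (Q⁻¹)ᵀ * diagonal (fun i => (d i)⁻¹) * Q⁻¹ := by
  have : (diagonal d)⁻¹ = diagonal (fun i => (d i)⁻¹) :=
    inv_eq_right_inv (by
      rw [diagonal_mul_diagonal, ← diagonal_one]
      congr 1
      funext i
      exact mul_inv_cancel₀ (hd i))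
  rw [Matrix.mul_inv_rev, Matrix.mul_inv_rev, this, transpose_nonsing_inv, Matrix.mul_assoc]

theorem logDetForm_congruence_diagonal {Q V : Matrix ι ι ℝ} {d : ι → ℝ} (hd : ∀ i, d i ≠ 0)
    (hV : V.IsHermitian) :
    logDetForm (Q * diagonal d * Qᵀ) V =
      ∑ i, ∑ j, (d i)⁻¹ * (d j)⁻¹ * (Q⁻¹ * V * (Q⁻¹)ᵀ) i j ^ 2 := by
  set u := Q⁻¹ * V * (Q⁻¹)ᵀ with hu
  have hsymm : ∀ i j, u j i = u i j := by
    have := isHermitian_mul_mul_conjTranspose Q⁻¹ hV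
    rw [conjTranspose_eq_transpose_of_trivial, ← hu] at this
    intro i j
    simpa using this.apply i j
  have : logDetForm (Q * diagonal d * Qᵀ) V =
      (diagonal (fun i => (d i)⁻¹) * u * (diagonal (fun i => (d i)⁻¹) * u)).trace := by
    rw [logDetForm, inv_congruence_diagonal hd, hu]
    simp only [Matrix.mul_assoc]
    rw [trace_mul_comm]
    simp only [Matrix.mul_assoc]
  rw [this, trace]
  simp only [diag_apply, mul_apply (M := _ * u), diagonal_mul]
  refine Finset.sum_congr rfl fun i _ => Finset.sum_congr rfl fun j _ => ?_
  rw [hsymm i j]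
  ring

theorem logDetForm_congruence {Q V : Matrix ι ι ℝ} (hV : V.IsHermitian) :
    logDetForm (Q * Qᵀ) V = ∑ i, ∑ j, (Q⁻¹ * V * (Q⁻¹)ᵀ) i j ^ 2 := by
  have := logDetForm_congruence_diagonal (Q := Q) (d := fun _ => 1) (fun _ => one_ne_zero) hV
  simpa using this

theorem logDetForm_nonneg {Y V : Matrix ι ι ℝ} (hY : Y.PosDef) (hV : V.IsHermitian) :
    0 ≤ logDetForm Y V := by
  obtain ⟨Q, d, -, hYQ, -⟩ := exists_congruence_diagonal hY hV
  rw [hYQ, logDetForm_congruence hV]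
  positivity

theorem logDetForm_pos {Y V : Matrix ι ι ℝ} (hY : Y.PosDef) (hV : V.IsHermitian) (hV0 : V ≠ 0) :
    0 < logDetForm Y V := by
  obtain ⟨Q, d, hQ, hYQ, -⟩ := exists_congruence_diagonal hY hV
  have hdet : IsUnit Q.det := (isUnit_iff_isUnit_det Q).1 hQ
  rw [hYQ, logDetForm_congruence hV]
  refine lt_of_le_of_ne (by positivity) fun h => hV0 ?_
  have h0 : Q⁻¹ * V * (Q⁻¹)ᵀ = 0 := by
    ext i j
    have h1 := (Finset.sum_eq_zero_iff_of_nonneg (fun i _ => by positivity)).1 h.symm i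
      (Finset.mem_univ _)
    have h2 := (Finset.sum_eq_zero_iff_of_nonneg (fun i _ => by positivity)).1 h1 j
      (Finset.mem_univ _)
    simpa using h2
  calc V = Q * (Q⁻¹ * V * (Q⁻¹)ᵀ) * Qᵀ := by
        rw [transpose_nonsing_inv, Matrix.mul_assoc Q⁻¹, mul_nonsing_inv_cancel_left _ _ hdet,
          nonsing_inv_mul_cancel_right _ _ (by rwa [det_transpose])]
    _ = 0 := by simp [h0]

theorem logDetForm_self {Y : Matrix ι ι ℝ} (hY : Y.PosDef) :
    logDetForm Y Y = Fintype.card ι := by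
  have hdet : IsUnit Y.det := (isUnit_iff_isUnit_det Y).1 hY.isUnit
  rw [logDetForm, nonsing_inv_mul _ hdet, Matrix.one_mul, nonsing_inv_mul _ hdet, trace_one]

/-- In common coordinates the hypothesis reads `∑ (d_i - 1)² ≤ t²`, so every `d_i` lies in `[1 - t,
1 + t]`; the two forms are then compared term by term. -/
theorem posDef_and_logDetForm_bounds {Y Z : Matrix ι ι ℝ} (hY : Y.PosDef) (hZ : Z.IsHermitian)
    {t : ℝ} (ht0 : 0 ≤ t) (ht1 : t < 1) (ht : logDetForm Y (Z - Y) ≤ t ^ 2) :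
    Z.PosDef ∧ ∀ V : Matrix ι ι ℝ, V.IsHermitian →
      (1 - t) ^ 2 * logDetForm Y V ≤ logDetForm Z V ∧
        (1 - t) ^ 2 * logDetForm Z V ≤ logDetForm Y V := by
  obtain ⟨Q, d, hQ, hYQ, hZQ⟩ := exists_congruence_diagonal hY hZ
  have hdet : IsUnit Q.det := (isUnit_iff_isUnit_det Q).1 hQ
  have hdiff : Q⁻¹ * (Z - Y) * (Q⁻¹)ᵀ = diagonal (fun i => d i - 1) := by
    have : Z - Y = Q * diagonal (fun i => d i - 1) * Qᵀ := by
      rw [hZQ, hYQ, ← diagonal_sub, diagonal_one, Matrix.mul_sub, Matrix.mul_one, Matrix.sub_mul]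
    rw [this, transpose_nonsing_inv, Matrix.mul_assoc Q, nonsing_inv_mul_cancel_left _ _ hdet,
      mul_nonsing_inv_cancel_right _ _ (by rwa [det_transpose])]
  have hdt : ∀ i, |d i - 1| ≤ t := by
    intro i
    apply abs_le_of_sq_le_sq _ ht0
    refine le_trans ?_ ht
    rw [hYQ, logDetForm_congruence (hYQ ▸ hZ.sub hY.1), ← hYQ, hdiff]
    refine le_trans ?_ (Finset.single_le_sum (f := fun i => ∑ j,
      (diagonal (fun i => d i - 1) : Matrix ι ι ℝ) i j ^ 2)
      (fun i _ => by positivity) (Finset.mem_univ i))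
    refine le_trans ?_ (Finset.single_le_sum (f := fun j =>
      (diagonal (fun i => d i - 1) : Matrix ι ι ℝ) i j ^ 2)
      (fun i _ => by positivity) (Finset.mem_univ i))
    simp
  have hlow : ∀ i, 1 - t ≤ d i := fun i => by linarith [(abs_le.1 (hdt i)).1]
  have hupp : ∀ i, d i ≤ 1 + t := fun i => by linarith [(abs_le.1 (hdt i)).2]
  have hpos : ∀ i, 0 < d i := fun i => by linarith [hlow i]
  refine ⟨?_, fun V hV => ?_⟩
  · have := (posDef_diagonal_iff.2 hpos).mul_mul_conjTranspose_same (B := Q)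
      (vecMul_injective_iff_isUnit.2 hQ)
    rwa [conjTranspose_eq_transpose_of_trivial, ← hZQ] at this
  · rw [hYQ, hZQ, logDetForm_congruence hV,
      logDetForm_congruence_diagonal (fun i => (hpos i).ne') hV]
    simp only [Finset.mul_sum]
    constructor
    · refine Finset.sum_le_sum fun i _ => Finset.sum_le_sum fun j _ =>
        mul_le_mul_of_nonneg_right ?_ (sq_nonneg _)
      -- Uses `d_i ≤ 1 + t ≤ (1 - t)⁻¹`.
      have h : ∀ i, 1 - t ≤ (d i)⁻¹ := fun i => by
        rw [le_inv_comm₀ (by linarith) (hpos i)]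
        refine (hupp i).trans ?_
        rw [← one_div, le_div_iff₀ (by linarith)]
        nlinarith
      rw [sq]
      exact mul_le_mul (h i) (h j) (by linarith) (inv_pos.2 (hpos i)).le
    · refine Finset.sum_le_sum fun i _ => Finset.sum_le_sum fun j _ => ?_
      have h : ∀ i, (1 - t) * (d i)⁻¹ ≤ 1 := fun i => by
        rw [← div_eq_mul_inv, div_le_one (hpos i)]
        exact hlow i
      have h0 : ∀ i, 0 ≤ (1 - t) * (d i)⁻¹ := fun i =>
        mul_nonneg (by linarith) (inv_pos.2 (hpos i)).le
      calc (1 - t) ^ 2 * ((d i)⁻¹ * (d j)⁻¹ * (Q⁻¹ * V * (Q⁻¹)ᵀ) i j ^ 2)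
          = ((1 - t) * (d i)⁻¹) * ((1 - t) * (d j)⁻¹) * (Q⁻¹ * V * (Q⁻¹)ᵀ) i j ^ 2 := by ring
        _ ≤ 1 * (Q⁻¹ * V * (Q⁻¹)ᵀ) i j ^ 2 :=
          mul_le_mul_of_nonneg_right (mul_le_one₀ (h i) (h0 j) (h j)) (sq_nonneg _)
        _ = _ := one_mul _

/-- The tangent inequality expressing the concavity of `log det`. -/
theorem log_det_le {A B : Matrix ι ι ℝ} (hA : A.PosDef) (hB : B.PosDef) :
    Real.log B.det ≤ Real.log A.det + (A⁻¹ * B).trace - Fintype.card ι := by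
  obtain ⟨Q, d, hQ, hAQ, hBQ⟩ := exists_congruence_diagonal hA hB.1
  have hdet : IsUnit Q.det := (isUnit_iff_isUnit_det Q).1 hQ
  have hd : ∀ i, 0 < d i := by
    have := (hBQ ▸ hB).conjTranspose_mul_mul_same (B := (Q⁻¹)ᵀ)
      (mulVec_injective_iff_isUnit.2 ((isUnit_transpose _).2 ((isUnit_nonsing_inv_iff).2 hQ)))
    rw [conjTranspose_eq_transpose_of_trivial, transpose_transpose, transpose_nonsing_inv,
      Matrix.mul_assoc Q, nonsing_inv_mul_cancel_left _ _ hdet,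
      mul_nonsing_inv_cancel_right _ _ (by rwa [det_transpose])] at this
    exact posDef_diagonal_iff.1 this
  have htr : (A⁻¹ * B).trace = ∑ i, d i := by
    rw [hAQ, hBQ, Matrix.mul_inv_rev, Matrix.mul_assoc, Matrix.mul_assoc Q,
      nonsing_inv_mul_cancel_left _ _ hdet, trace_mul_comm,
      mul_nonsing_inv_cancel_right _ _ (by rwa [det_transpose]), trace_diagonal]
  have hdetB : B.det = A.det * ∏ i, d i := by
    rw [hAQ, hBQ, det_mul, det_mul, det_mul, det_diagonal]
    ring
  rw [hdetB, Real.log_mul hA.det_pos.ne' (Finset.prod_pos fun i _ => hd i).ne',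
    Real.log_prod (fun i _ => (hd i).ne'), htr]
  have : ∑ i, Real.log (d i) ≤ ∑ i, (d i - 1) :=
    Finset.sum_le_sum fun i _ => Real.log_le_sub_one_of_pos (hd i)
  rw [Finset.sum_sub_distrib] at this
  simp only [Finset.sum_const, Finset.card_univ, nsmul_eq_mul, mul_one] at this
  linarith

end Matrices

end FactorWidth

namespace FactorWidth

/-! ### Passage from single matrices to families; the interior of the cone. -/

section Families

open Matrix Topology

variable {n k : ℕ}

theorem block_apply (Y : symFamilies n k) (J : KSubset n k) (a b : Fin k) :
    block Y J a b = Y.1 (J, a, b) := rfl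

theorem block_isHermitian (Y : symFamilies n k) (J : KSubset n k) : (block Y J).IsHermitian := by
  ext a b
  exact Y.2 J b a

/-- The map `Y ↦ Y_J` as a linear map. -/
def blockLin (J : KSubset n k) : symFamilies n k →ₗ[ℝ] Matrix (Fin k) (Fin k) ℝ where
  toFun Y := block Y J
  map_add' _ _ := rfl
  map_smul' _ _ := rfl

theorem block_sub (Y Z : symFamilies n k) (J : KSubset n k) :
    block (Y - Z) J = block Y J - block Z J := rfl

theorem block_neg (Y : symFamilies n k) (J : KSubset n k) :
    block (-Y) J = -block Y J := rfl

theorem block_ext {Y Z : symFamilies n k} (h : ∀ J, block Y J = block Z J) : Y = Z := by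
  apply Subtype.ext
  ext ⟨J, a, b⟩
  exact congrFun (congrFun (h J) a) b

theorem continuous_block (J : KSubset n k) :
    Continuous fun Y : symFamilies n k => block Y J :=
  (blockLin J).continuous_of_finiteDimensional

/-- The family of symmetric parts of a family of matrices. -/
noncomputable def ofBlocks :
    (KSubset n k → Matrix (Fin k) (Fin k) ℝ) →ₗ[ℝ] symFamilies n k where
  toFun M := ⟨WithLp.toLp 2 fun p => (M p.1 p.2.1 p.2.2 + M p.1 p.2.2 p.2.1) / 2,
    fun J a b => by simp [add_comm]⟩
  map_add' M N := by
    apply Subtype.ext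
    ext p
    simp
    ring
  map_smul' c M := by
    apply Subtype.ext
    ext p
    simp
    ring

theorem block_ofBlocks {M : KSubset n k → Matrix (Fin k) (Fin k) ℝ} (hM : ∀ J, (M J).IsHermitian)
    (J : KSubset n k) : block (ofBlocks M) J = M J := by
  ext a b
  have : M J b a = M J a b := by simpa using (hM J).apply a b
  simp [block_apply, ofBlocks, this]

theorem inner_eq_sum_trace (Y Z : symFamilies n k) :
    inner ℝ Y Z = ∑ J, (block Y J * block Z J).trace := by
  rw [Submodule.coe_inner, PiLp.inner_apply, Fintype.sum_prod_type]
  refine Finset.sum_congr rfl fun J _ => ?_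
  rw [Fintype.sum_prod_type, trace]
  refine Finset.sum_congr rfl fun a _ => ?_
  rw [diag_apply, mul_apply]
  refine Finset.sum_congr rfl fun b _ => ?_
  rw [block_apply, block_apply, Z.2 J b a]
  simp [mul_comm]

/-- The families of positive definite matrices. -/
def posDefFamilies (n k : ℕ) : Set (symFamilies n k) :=
  {Y | ∀ J, (block Y J).PosDef}

/-- The quadratic form `V ↦ ∑_J tr (Y_J⁻¹ V_J Y_J⁻¹ V_J)`. -/
noncomputable def familyForm (Y V : symFamilies n k) : ℝ :=
  ∑ J, logDetForm (block Y J) (block V J)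

theorem familyForm_nonneg {Y : symFamilies n k} (hY : Y ∈ posDefFamilies n k)
    (V : symFamilies n k) : 0 ≤ familyForm Y V :=
  Finset.sum_nonneg fun J _ => logDetForm_nonneg (hY J) (block_isHermitian V J)

theorem familyForm_pos {Y V : symFamilies n k} (hY : Y ∈ posDefFamilies n k) (hV : V ≠ 0) :
    0 < familyForm Y V := by
  obtain ⟨J, hJ⟩ : ∃ J, block V J ≠ 0 := by
    by_contra! h
    exact hV (block_ext fun J => h J)
  exact Finset.sum_pos' (fun J _ => logDetForm_nonneg (hY J) (block_isHermitian V J))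
    ⟨J, Finset.mem_univ _, logDetForm_pos (hY J) (block_isHermitian V J) hJ⟩

theorem continuous_familyForm (Y : symFamilies n k) : Continuous (familyForm Y) := by
  refine continuous_finsetSum _ fun J _ => ?_
  have := continuous_block J
  unfold logDetForm
  fun_prop

theorem posDef_and_familyForm_bounds {Y Z : symFamilies n k} (hY : Y ∈ posDefFamilies n k)
    {t : ℝ} (ht0 : 0 ≤ t) (ht1 : t < 1) (ht : familyForm Y (Z - Y) ≤ t ^ 2) :
    Z ∈ posDefFamilies n k ∧ ∀ V, (1 - t) ^ 2 * familyForm Y V ≤ familyForm Z V ∧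
        (1 - t) ^ 2 * familyForm Z V ≤ familyForm Y V := by
  have key := fun J => posDef_and_logDetForm_bounds (hY J) (block_isHermitian Z J) ht0 ht1
    ((Finset.single_le_sum (f := fun J => logDetForm (block Y J) (block (Z - Y) J))
      (fun J _ => logDetForm_nonneg (hY J) (block_isHermitian _ J)) (Finset.mem_univ J)).trans ht)
  refine ⟨fun J => (key J).1, fun V => ?_⟩
  simp only [familyForm, Finset.mul_sum]
  exact ⟨Finset.sum_le_sum fun J _ => ((key J).2 _ (block_isHermitian V J)).1,
    Finset.sum_le_sum fun J _ => ((key J).2 _ (block_isHermitian V J)).2⟩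

/-- Around `Y`, the set where the continuous function `familyForm Y (Z - Y)` is below `1/4` consists
of positive definite families: the previous bounds with `t = 1/2`. -/
theorem isOpen_posDefFamilies : IsOpen (posDefFamilies n k) := by
  rw [isOpen_iff_mem_nhds]
  intro Y hY
  have hc : Continuous fun Z => familyForm Y (Z - Y) :=
    (continuous_familyForm Y).comp (continuous_id.sub continuous_const)
  have h0 : familyForm Y (Y - Y) < (1 / 2) ^ 2 := by
    have : ∀ J, block (0 : symFamilies n k) J = 0 := fun _ => rfl
    simp [familyForm, logDetForm, this]
  filter_upwards [hc.continuousAt.eventually_lt continuousAt_const h0] with Z hZ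
  exact (posDef_and_familyForm_bounds hY (by norm_num) (by norm_num) hZ.le).1

/-- An interior `Y` stays semidefinite after subtracting a small `t > 0` times the identity family,
so each block is semidefinite plus `t • 1`. -/
theorem interior_psdFamilies : interior (psdFamilies n k) = posDefFamilies n k := by
  apply Set.Subset.antisymm
  · intro Y hY
    set I : symFamilies n k := ofBlocks fun _ => 1
    have hI : ∀ J, block I J = 1 := block_ofBlocks fun _ => isHermitian_one
    have hc : Filter.Tendsto (fun t : ℝ => Y - t • I) (𝓝[>] 0) (𝓝 Y) := by
      have : Continuous fun t : ℝ => Y - t • I := by fun_prop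
      simpa using this.continuousAt.continuousWithinAt.tendsto (x := (0 : ℝ)) (s := Set.Ioi 0)
    obtain ⟨t, htpsd, ht⟩ :=
      ((hc.eventually (mem_interior_iff_mem_nhds.1 hY)).and self_mem_nhdsWithin).exists
    intro J
    have h1 : (block Y J - t • 1).PosSemidef := by
      have := htpsd J
      rwa [block_sub, show block (t • I) J = t • block I J from rfl, hI] at this
    have := PosDef.posSemidef_add h1 ((PosDef.one (n := Fin k) (R := ℝ)).smul ht)
    simpa using this
  · exact interior_maximal (fun Y hY J => (hY J).posSemidef) isOpen_posDefFamilies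

theorem convex_posDefFamilies : Convex ℝ (posDefFamilies n k) := by
  rw [convex_iff_forall_pos]
  intro Y hY Z hZ a b ha hb _ J
  exact ((hY J).smul ha).add ((hZ J).smul hb)

theorem contDiffOn_fFW : ContDiffOn ℝ 2 (fFW : symFamilies n k → ℝ) (posDefFamilies n k) := by
  intro Y hY
  apply ContDiffAt.contDiffWithinAt
  refine ContDiffAt.neg (ContDiffAt.sum fun J _ => ContDiffAt.log ?_ (hY J).det_pos.ne')
  have hentry : ∀ a b, ContDiff ℝ 2 fun Y : symFamilies n k => block Y J a b := fun a b =>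
    (((LinearMap.proj b).comp (LinearMap.proj a)).comp
      ((ofLinearEquiv ℝ).symm.toLinearMap.comp (blockLin J))).toContinuousLinearMap.contDiff
  simp only [det_apply]
  refine ContDiffAt.sum fun σ _ => ContDiffAt.const_smul _ ?_
  exact (contDiff_prod fun a _ => hentry _ _).contDiffAt

end Families

end FactorWidth

namespace FactorWidth

/-! ### Gradient, Hessian and the barrier property. -/

section Calculus

open Matrix Topology

variable {n k : ℕ}

/-- The family of inverses `Y_J⁻¹`. -/
noncomputable def invFamily (Y : symFamilies n k) : symFamilies n k :=
  ofBlocks fun J => (block Y J)⁻¹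

theorem block_invFamily (Y : symFamilies n k) (J : KSubset n k) :
    block (invFamily Y) J = (block Y J)⁻¹ :=
  block_ofBlocks (fun J => (block_isHermitian Y J).inv) J

/-- No determinant is differentiated explicitly: by `log_det_le`, `fFW` plus the linear functional
`⟨Y⁻¹, ·⟩` has a local minimum at `Y`, so its derivative vanishes there. -/
theorem hasGradientAt_fFW {Y : symFamilies n k} (hY : Y ∈ posDefFamilies n k) :
    HasGradientAt fFW (-invFamily Y) Y := by
  have hnhds := isOpen_posDefFamilies.mem_nhds hY
  have hdiff : HasFDerivAt fFW (fderiv ℝ fFW Y) Y :=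
    ((contDiffOn_fFW.contDiffAt hnhds).differentiableAt (by norm_num)).hasFDerivAt
  have hmin : IsLocalMin (fun Z => fFW Z + innerSL ℝ (invFamily Y) Z) Y := by
    filter_upwards [hnhds] with Z hZ
    simp only [innerSL_apply_apply, inner_eq_sum_trace, block_invFamily, fFW]
    have := Finset.sum_le_sum fun (J : KSubset n k) (_ : J ∈ Finset.univ) =>
      log_det_le (hY J) (hZ J)
    simp only [Finset.sum_add_distrib, Finset.sum_sub_distrib] at this
    have htr : ∀ J, ((block Y J)⁻¹ * block Y J).trace = Fintype.card (Fin k) := fun J => by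
      rw [nonsing_inv_mul _ ((isUnit_iff_isUnit_det _).1 (hY J).isUnit), trace_one]
    simp only [htr]
    linarith
  have h0 := hmin.hasFDerivAt_eq_zero (hdiff.add (innerSL ℝ (invFamily Y)).hasFDerivAt)
  have hdual : InnerProductSpace.toDual ℝ _ (-invFamily Y) = fderiv ℝ fFW Y := by
    ext V
    rw [InnerProductSpace.toDual_apply_apply, inner_neg_left, eq_neg_of_add_eq_zero_left h0]
    rfl
  rwa [hasGradientAt_iff_hasFDerivAt, hdual]

-- The operator norm makes matrices a complete normed algebra, where the derivative of inversion is
-- known; it occurs only in the intermediate space.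
open scoped Matrix.Norms.Operator in
theorem hasFDerivAt_invFamily {Y : symFamilies n k} (hY : Y ∈ posDefFamilies n k) :
    ∃ L : symFamilies n k →L[ℝ] symFamilies n k, HasFDerivAt invFamily L Y ∧
      ∀ V, L V = -ofBlocks fun J => (block Y J)⁻¹ * block V J * (block Y J)⁻¹ := by
  have hinv : ∀ J, HasFDerivAt (fun Z : symFamilies n k => (block Z J)⁻¹)
      ((-ContinuousLinearMap.mulLeftRight ℝ (Matrix (Fin k) (Fin k) ℝ)
        (block Y J)⁻¹ (block Y J)⁻¹).comp (blockLin J).toContinuousLinearMap) Y := by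
    intro J
    have h := hasFDerivAt_ringInverse (𝕜 := ℝ) (hY J).isUnit.unit
    have h2 : ((hY J).isUnit.unit⁻¹ : (Matrix (Fin k) (Fin k) ℝ)ˣ) = (block Y J)⁻¹ := by
      rw [coe_units_inv, IsUnit.unit_spec]
    rw [h2, IsUnit.unit_spec] at h
    have := h.comp (x := Y) (f := fun Z => block Z J) (blockLin J).toContinuousLinearMap.hasFDerivAt
    simp only [nonsing_inv_eq_ringInverse] at this ⊢
    exact this
  refine ⟨_, ((ofBlocks (n := n) (k := k)).toContinuousLinearMap.hasFDerivAt).comp Y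
    (hasFDerivAt_pi.2 hinv), fun V => ?_⟩
  rw [← map_neg]
  rfl

theorem hessian_fFW {Y : symFamilies n k} (hY : Y ∈ posDefFamilies n k) (V : symFamilies n k) :
    hessian fFW Y V = ofBlocks fun J => (block Y J)⁻¹ * block V J * (block Y J)⁻¹ := by
  obtain ⟨L, hL, hLV⟩ := hasFDerivAt_invFamily hY
  have heq : gradient fFW =ᶠ[𝓝 Y] -invFamily := by
    filter_upwards [isOpen_posDefFamilies.mem_nhds hY] with Z hZ
    exact (hasGradientAt_fFW hZ).gradient
  rw [hessian, heq.fderiv_eq, hL.neg.fderiv]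
  simp [hLV]

theorem block_hessian_fFW {Y : symFamilies n k} (hY : Y ∈ posDefFamilies n k)
    (V : symFamilies n k) (J : KSubset n k) :
    block (hessian fFW Y V) J = (block Y J)⁻¹ * block V J * (block Y J)⁻¹ := by
  rw [hessian_fFW hY, block_ofBlocks]
  intro J
  have := isHermitian_mul_mul_conjTranspose (block Y J)⁻¹ (block_isHermitian V J)
  rwa [(block_isHermitian Y J).inv.eq] at this

theorem localInner_fFW {Y : symFamilies n k} (hY : Y ∈ posDefFamilies n k) (V : symFamilies n k) :
    localInner fFW Y V V = familyForm Y V := by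
  rw [localInner, inner_eq_sum_trace, familyForm]
  refine Finset.sum_congr rfl fun J _ => ?_
  rw [block_hessian_fFW hY, logDetForm, trace_mul_comm]

theorem localNorm_fFW {Y : symFamilies n k} (hY : Y ∈ posDefFamilies n k) (V : symFamilies n k) :
    localNorm fFW Y V = √(familyForm Y V) := by
  rw [localNorm, localInner_fFW hY]

theorem posDef_and_bounds_of_mem_localBall {Y Z : symFamilies n k} (hY : Y ∈ posDefFamilies n k)
    (hZ : Z ∈ localBall fFW Y Y 1) :
    Z ∈ posDefFamilies n k ∧ ∀ V,
      (1 - localNorm fFW Y (Z - Y)) ^ 2 * familyForm Y V ≤ familyForm Z V ∧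
        (1 - localNorm fFW Y (Z - Y)) ^ 2 * familyForm Z V ≤ familyForm Y V := by
  refine posDef_and_familyForm_bounds hY (Real.sqrt_nonneg _) hZ ?_
  rw [localNorm_fFW hY, Real.sq_sqrt (familyForm_nonneg hY _)]

theorem isSelfConcordant_fFW :
    IsSelfConcordant (fFW : symFamilies n k → ℝ) (posDefFamilies n k) where
  isOpen := isOpen_posDefFamilies
  convex := convex_posDefFamilies
  contDiffOn := contDiffOn_fFW
  hessian_pos Y hY V hV := by
    rw [localInner_fFW hY]
    exact familyForm_pos hY hV
  ball_subset Y hY Z hZ := (posDef_and_bounds_of_mem_localBall hY hZ).1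
  norm_ratio Y hY Z hZ V hV := by
    obtain ⟨hZpos, hbounds⟩ := posDef_and_bounds_of_mem_localBall hY hZ
    obtain ⟨h1, h2⟩ := hbounds V
    have ht : 0 < 1 - localNorm fFW Y (Z - Y) := sub_pos.2 hZ
    have hsqrt : ∀ {a b : ℝ}, (1 - localNorm fFW Y (Z - Y)) ^ 2 * a ≤ b →
        (1 - localNorm fFW Y (Z - Y)) * √a ≤ √b := fun {a b} hab => by
      have := Real.sqrt_le_sqrt hab
      rwa [Real.sqrt_mul (sq_nonneg _), Real.sqrt_sq ht.le] at this
    rw [localNorm_fFW hZpos V, localNorm_fFW hY V]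
    have hpos : 0 < √(familyForm Y V) := Real.sqrt_pos.2 (familyForm_pos hY hV)
    refine ⟨(le_div_iff₀ hpos).2 (hsqrt h1), ?_⟩
    rw [div_le_div_iff₀ hpos ht, one_mul, mul_comm]
    exact hsqrt h2

/-- Blockwise `H(Y)(-Y) = -Y⁻¹ Y Y⁻¹ = -Y⁻¹`, which is the gradient. -/
theorem inverse_hessian_gradient_fFW {Y : symFamilies n k} (hY : Y ∈ posDefFamilies n k) :
    (hessian fFW Y).inverse (gradient fFW Y) = -Y := by
  -- `ContinuousLinearMap.inverse` is zero on non-invertible operators, so invertibility has to be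
  -- established.
  have hinj : Function.Injective (hessian fFW Y : symFamilies n k →ₗ[ℝ] symFamilies n k) := by
    rw [injective_iff_map_eq_zero]
    intro V hV
    by_contra hV0
    have := isSelfConcordant_fFW.hessian_pos Y hY V hV0
    rw [localInner, show hessian fFW Y V = 0 from hV, inner_zero_right] at this
    exact this.false
  let e := (LinearEquiv.ofInjectiveEndo _ hinj).toContinuousLinearEquiv
  have he : hessian fFW Y = (e : symFamilies n k →L[ℝ] symFamilies n k) := rfl
  have hg : hessian fFW Y (-Y) = gradient fFW Y := by
    rw [(hasGradientAt_fFW hY).gradient, map_neg]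
    refine congrArg _ (block_ext fun J => ?_)
    rw [block_hessian_fFW hY, block_invFamily,
      nonsing_inv_mul _ ((isUnit_iff_isUnit_det _).1 (hY J).isUnit), Matrix.one_mul]
  rw [← hg, he, ContinuousLinearMap.inverse_equiv]
  exact e.symm_apply_apply _

theorem isSelfConcordantBarrier_fFW :
    IsSelfConcordantBarrier (fFW : symFamilies n k → ℝ) (posDefFamilies n k) where
  toIsSelfConcordant := isSelfConcordant_fFW
  complexity_finite := by
    -- Each block contributes `tr 1 = k` to `‖-Y‖_Y²`.
    refine ⟨∑ _J : KSubset n k, (k : ℝ), ?_⟩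
    rintro _ ⟨Y, hY, rfl⟩
    simp only [inverse_hessian_gradient_fFW hY]
    rw [localNorm_fFW hY, Real.sq_sqrt (familyForm_nonneg hY _)]
    refine Finset.sum_le_sum fun J _ => ?_
    have : logDetForm (block Y J) (block (-Y) J) = logDetForm (block Y J) (block Y J) := by
      simp [logDetForm, block_neg]
    rw [this, logDetForm_self (hY J), Fintype.card_fin]

end Calculus

end FactorWidth

namespace FactorWidth

/-! ### Uniform averaging over partitions. -/

section Averaging

/-- If the fibres of `f` are permuted transitively, then averaging along `f` is uniform. -/
theorem card_mul_sum_comp_of_transitive {α β : Type*} [Fintype α] [Fintype β] [DecidableEq β]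
    (f : α → β) (hf : ∀ b b', ∃ σ : Equiv.Perm α, ∀ a, f a = b → f (σ a) = b') (F : β → ℝ) :
    (Fintype.card β : ℝ) * ∑ a, F (f a) = Fintype.card α * ∑ b, F b := by
  -- A permutation injects one fibre into another; by symmetry all fibres have the same size.
  have hle : ∀ b b', (Finset.univ.filter fun a => f a = b).card ≤
      (Finset.univ.filter fun a => f a = b').card := by
    intro b b'
    obtain ⟨σ, hσ⟩ := hf b b'
    exact Finset.card_le_card_of_injOn σ (fun a ha => by simpa using hσ a (by simpa using ha))
      σ.injective.injOn
  have hcard : ∀ b, Fintype.card β * (Finset.univ.filter fun a => f a = b).card =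
      Fintype.card α := by
    intro b
    have := Finset.card_eq_sum_card_fiberwise (f := f) (s := Finset.univ) (t := Finset.univ)
      (by simp)
    rw [Finset.sum_congr rfl fun b' _ => (hle b' b).antisymm (hle b b')] at this
    simpa using this.symm
  rw [← Finset.sum_fiberwise (g := f), Finset.mul_sum, Finset.mul_sum]
  refine Finset.sum_congr rfl fun b _ => ?_
  rw [Finset.sum_congr rfl fun a ha => by rw [(Finset.mem_filter.1 ha).2], Finset.sum_const,
    nsmul_eq_mul, ← mul_assoc, ← hcard b, Nat.cast_mul]

variable {n k m : ℕ}

/-- The `b`-th block of the partition of `[n]` into `k`-element subsets given by `e`. -/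
def partBlock (e : Fin k × Fin m ≃ Fin n) (b : Fin m) : KSubset n k :=
  ⟨Finset.univ.map ⟨fun a => e (a, b), fun a a' h => by simpa using h⟩, by simp⟩

theorem mem_partBlock {e : Fin k × Fin m ≃ Fin n} {b : Fin m} {i : Fin n} :
    i ∈ (partBlock e b).1 ↔ ∃ a, e (a, b) = i := by
  simp only [partBlock, Finset.mem_map, Finset.mem_univ, true_and]
  rfl

theorem exists_perm_map_eq (J J' : KSubset n k) :
    ∃ π : Equiv.Perm (Fin n), J.1.map π.toEmbedding = J'.1 := by
  let ε : {x // x ∈ J.1} ≃ {x // x ∈ J'.1} := Finset.equivOfCardEq (J.2.trans J'.2.symm)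
  refine ⟨ε.extendSubtype, Finset.eq_of_subset_of_card_le ?_ (by simp [J.2, J'.2])⟩
  intro i hi
  obtain ⟨j, hj, rfl⟩ := Finset.mem_map.1 hi
  exact ε.extendSubtype_mem j hj

/-- Composing `e` with permutations of `[n]` acts transitively on the possible `b`-th blocks, so
each `J` occurs for equally many `e`. -/
theorem card_mul_sum_partBlock (b : Fin m) (F : KSubset n k → ℝ) :
    (Fintype.card (KSubset n k) : ℝ) * ∑ e : Fin k × Fin m ≃ Fin n, F (partBlock e b) =
      Fintype.card (Fin k × Fin m ≃ Fin n) * ∑ J, F J := by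
  refine card_mul_sum_comp_of_transitive (fun e => partBlock e b) (fun J J' => ?_) F
  obtain ⟨π, hπ⟩ := exists_perm_map_eq J J'
  refine ⟨Equiv.equivCongr (Equiv.refl _) π, ?_⟩
  rintro e rfl
  apply Subtype.ext
  rw [← hπ]
  ext i
  simp [mem_partBlock, Equiv.eq_symm_apply]

end Averaging

/-! ### Zero extension, independently of how `J` is enumerated. -/

section Extension

open Matrix

variable {n k m : ℕ}

/-- The enumeration `g` of `J` need not be increasing, because the blocks cut out by `e` come in
arbitrary order. -/
theorem sum_mul_extendByZero (J : KSubset n k) (S : Matrix (Fin k) (Fin k) ℝ)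
    {g : Fin k → Fin n} (hg : Function.Injective g) (hJ : ∀ i, i ∈ J.1 ↔ ∃ a, g a = i)
    (c : Fin n → Fin n → ℝ) :
    ∑ i, ∑ j, c i j * extendByZero J S j i =
      ∑ a, ∑ b, c (g a) (g b) * extendByZero J S (g b) (g a) := by
  have hzero : ∀ i j, ¬ ((∃ a, g a = i) ∧ ∃ b, g b = j) → extendByZero J S i j = 0 := by
    intro i j h
    rw [← hJ, ← hJ] at h
    simp only [extendByZero, of_apply, dif_neg h]
  symm
  refine Fintype.sum_of_injective g hg _ _ (fun i hi => ?_) fun a => ?_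
  · exact Finset.sum_eq_zero fun j _ => by rw [hzero _ _ (fun h => hi h.2), mul_zero]
  · exact Fintype.sum_of_injective g hg _ _
      (fun j hj => by rw [hzero _ _ (fun h => hj h.1), mul_zero]) fun b => rfl

theorem trace_mul_extendByZero (J : KSubset n k) (S : Matrix (Fin k) (Fin k) ℝ)
    {g : Fin k → Fin n} (hg : Function.Injective g) (hJ : ∀ i, i ∈ J.1 ↔ ∃ a, g a = i)
    (M : Matrix (Fin n) (Fin n) ℝ) :
    (M * extendByZero J S).trace =
      (M.submatrix g g * (extendByZero J S).submatrix g g).trace := by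
  simp only [trace, diag_apply, mul_apply, submatrix_apply]
  exact sum_mul_extendByZero J S hg hJ M

/-- Here `τ` compares `g` with the increasing enumeration; determinant and definiteness are
insensitive to it. -/
theorem exists_submatrix_extendByZero (J : KSubset n k) {g : Fin k → Fin n}
    (hg : Function.Injective g) (hJ : ∀ i, i ∈ J.1 ↔ ∃ a, g a = i) :
    ∃ τ : Equiv.Perm (Fin k), ∀ S : Matrix (Fin k) (Fin k) ℝ,
      (extendByZero J S).submatrix g g = S.submatrix τ τ := by
  have hmem : ∀ a, g a ∈ J.1 := fun a => (hJ _).2 ⟨a, rfl⟩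
  let τ : Fin k → Fin k := fun a => (J.1.orderIsoOfFin J.2).symm ⟨g a, hmem a⟩
  have hτ : Function.Injective τ := fun a a' h => by
    simpa [τ, hg.eq_iff] using h
  refine ⟨Equiv.ofBijective τ (Finite.injective_iff_bijective.1 hτ), fun S => ?_⟩
  ext a b
  simp [extendByZero, hmem, τ]

theorem posDef_submatrix_extendByZero {J : KSubset n k} {S : Matrix (Fin k) (Fin k) ℝ}
    (hS : S.PosDef) {g : Fin k → Fin n} (hg : Function.Injective g)
    (hJ : ∀ i, i ∈ J.1 ↔ ∃ a, g a = i) : ((extendByZero J S).submatrix g g).PosDef := by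
  obtain ⟨τ, hτ⟩ := exists_submatrix_extendByZero J hg hJ
  rw [hτ]
  exact hS.submatrix τ.injective

theorem det_submatrix_extendByZero (J : KSubset n k) (S : Matrix (Fin k) (Fin k) ℝ)
    {g : Fin k → Fin n} (hg : Function.Injective g) (hJ : ∀ i, i ∈ J.1 ↔ ∃ a, g a = i) :
    ((extendByZero J S).submatrix g g).det = S.det := by
  obtain ⟨τ, hτ⟩ := exists_submatrix_extendByZero J hg hJ
  rw [hτ, det_submatrix_equiv_self]

theorem extendByZero_isHermitian {J : KSubset n k} {S : Matrix (Fin k) (Fin k) ℝ}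
    (hS : S.IsHermitian) : (extendByZero J S).IsHermitian := by
  ext i j
  have hS' : ∀ a b, S a b = S b a := fun a b => by simpa using (hS.apply a b).symm
  simp only [conjTranspose_apply, extendByZero, of_apply, star_trivial]
  by_cases h : i ∈ J.1 ∧ j ∈ J.1
  · rw [dif_pos h, dif_pos h.symm, hS']
  · rw [dif_neg h, dif_neg fun h' => h h'.symm]

theorem mem_iff_exists_orderEmbOfFin (J : KSubset n k) (i : Fin n) :
    i ∈ J.1 ↔ ∃ a, J.1.orderEmbOfFin J.2 a = i := by
  rw [← Set.mem_range, Finset.range_orderEmbOfFin, Finset.mem_coe]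

theorem dotProduct_extendByZero_mulVec (J : KSubset n k) (S : Matrix (Fin k) (Fin k) ℝ)
    (x : Fin n → ℝ) :
    x ⬝ᵥ (extendByZero J S *ᵥ x) =
      (x ∘ J.1.orderEmbOfFin J.2) ⬝ᵥ ((extendByZero J S).submatrix (J.1.orderEmbOfFin J.2)
        (J.1.orderEmbOfFin J.2) *ᵥ (x ∘ J.1.orderEmbOfFin J.2)) := by
  have h := sum_mul_extendByZero J S (J.1.orderEmbOfFin J.2).injective
    (mem_iff_exists_orderEmbOfFin J) (fun i j => x i * x j)
  rw [Finset.sum_comm, Finset.sum_comm (s := (Finset.univ : Finset (Fin k)))] at h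
  simp only [dotProduct, mulVec, Finset.mul_sum, submatrix_apply, Function.comp_apply]
  convert h using 3 <;> ring

/-- All summands of the quadratic form are nonnegative, and a `k`-set containing an index with `x i
≠ 0` contributes strictly. -/
theorem posDef_Psi (hk : 0 < k) (hkn : k ≤ n) {Y : symFamilies n k}
    (hY : Y ∈ posDefFamilies n k) : (Psi Y).PosDef := by
  have hpos := fun J => posDef_submatrix_extendByZero (hY J) (J.1.orderEmbOfFin J.2).injective
    (mem_iff_exists_orderEmbOfFin J)
  refine PosDef.of_dotProduct_mulVec_pos ?_ fun x hx => ?_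
  · exact isSelfAdjoint_sum _ fun J _ => extendByZero_isHermitian (block_isHermitian Y J)
  obtain ⟨i, hi⟩ := Function.ne_iff.1 hx
  obtain ⟨T, hiT, hT⟩ := Finset.exists_superset_card_eq (s := {i}) (n := k) (by simpa using Nat.succ_le_of_lt hk)
    (by simpa using hkn)
  rw [Psi, sum_mulVec, dotProduct_sum]
  simp only [star_trivial, dotProduct_extendByZero_mulVec]
  refine Finset.sum_pos' (fun J _ => ?_) ⟨⟨T, hT⟩, Finset.mem_univ _, ?_⟩
  · simpa using (hpos J).posSemidef.dotProduct_mulVec_nonneg (x ∘ J.1.orderEmbOfFin J.2)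
  · have hne : x ∘ T.orderEmbOfFin hT ≠ 0 := by
      obtain ⟨a, ha⟩ := (mem_iff_exists_orderEmbOfFin ⟨T, hT⟩ i).1 (by simpa using hiT)
      intro h
      apply hi
      rw [← ha]
      exact congrFun h a
    simpa using (hpos ⟨T, hT⟩).dotProduct_mulVec_pos hne

/-! ### The inequality for one partition and its average. -/

variable {o ι : Type*} [Fintype o] [DecidableEq o] [Fintype ι]

theorem posDef_blockDiagonal {M : o → Matrix ι ι ℝ} (hM : ∀ b, (M b).PosDef) :
    (blockDiagonal M).PosDef := by
  refine PosDef.of_dotProduct_mulVec_pos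
    (isHermitian_blockDiagonal_iff.2 fun b => (hM b).1) fun x hx => ?_
  have hsum : star x ⬝ᵥ (blockDiagonal M *ᵥ x) =
      ∑ b, (fun a => x (a, b)) ⬝ᵥ (M b *ᵥ fun a => x (a, b)) := by
    simp only [star_trivial, dotProduct, mulVec, Fintype.sum_prod_type, blockDiagonal_apply,
      ite_mul, zero_mul, Finset.sum_ite_eq, Finset.mem_univ, if_true]
    exact Finset.sum_comm
  obtain ⟨⟨a, b⟩, hab⟩ := Function.ne_iff.1 hx
  rw [hsum]
  refine Finset.sum_pos' (fun b _ => ?_) ⟨b, Finset.mem_univ _, ?_⟩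
  · simpa using (hM b).posSemidef.dotProduct_mulVec_nonneg fun a => x (a, b)
  · have hne : (fun a => x (a, b)) ≠ 0 := fun h => hab (congrFun h a)
    simpa using (hM b).dotProduct_mulVec_pos hne

theorem trace_mul_blockDiagonal (N : Matrix (ι × o) (ι × o) ℝ) (M : o → Matrix ι ι ℝ) :
    (N * blockDiagonal M).trace =
      ∑ b, (N.submatrix (fun a => (a, b)) (fun a => (a, b)) * M b).trace := by
  simp only [trace, diag_apply, mul_apply, Fintype.sum_prod_type, blockDiagonal_apply,
    mul_ite, mul_zero, Finset.sum_ite_eq', Finset.mem_univ, if_true, submatrix_apply]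
  exact Finset.sum_comm

/-- After reindexing by `e`, the matrices `Y_J` of the partition form a block diagonal matrix; this
is the tangent inequality for it at `A`. -/
theorem sum_partBlock_le {A : Matrix (Fin n) (Fin n) ℝ} (hA : A.PosDef) {Y : symFamilies n k}
    (hY : Y ∈ posDefFamilies n k) (e : Fin k × Fin m ≃ Fin n) :
    ∑ b, (Real.log (block Y (partBlock e b)).det -
      (A⁻¹ * extendByZero (partBlock e b) (block Y (partBlock e b))).trace) ≤
        Real.log A.det - n := by
  have hg : ∀ b, Function.Injective fun a => e (a, b) := fun b a a' h => by simpa using h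
  obtain ⟨M, hM⟩ : ∃ M : Fin m → Matrix (Fin k) (Fin k) ℝ, ∀ b, M b =
    (extendByZero (partBlock e b) (block Y (partBlock e b))).submatrix
      (fun a => e (a, b)) (fun a => e (a, b)) := ⟨_, fun _ => rfl⟩
  have hMpos : ∀ b, (M b).PosDef := fun b => by
    rw [hM]
    exact posDef_submatrix_extendByZero (hY _) (hg b) fun _ => mem_partBlock
  have h := log_det_le (hA.submatrix e.injective) (posDef_blockDiagonal hMpos)
  rw [det_submatrix_equiv_self, det_blockDiagonal,
    Real.log_prod fun b _ => (hMpos b).det_pos.ne', inv_submatrix_equiv,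
    trace_mul_blockDiagonal, Fintype.card_congr e, Fintype.card_fin] at h
  have hdet : ∀ b, (M b).det = (block Y (partBlock e b)).det := fun b => by
    rw [hM]
    exact det_submatrix_extendByZero _ _ (hg b) fun _ => mem_partBlock
  have htr : ∀ b, ((A⁻¹.submatrix e e).submatrix (fun a => (a, b)) (fun a => (a, b)) * M b).trace =
      (A⁻¹ * extendByZero (partBlock e b) (block Y (partBlock e b))).trace := fun b => by
    rw [hM, trace_mul_extendByZero _ _ (hg b) (fun _ => mem_partBlock)]
    rfl
  simp only [hdet, htr] at h
  rw [Finset.sum_sub_distrib]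
  linarith

theorem sum_le_choose_mul (hk : 0 < k) (hn : 0 < n) (hkn : k ∣ n)
    {A : Matrix (Fin n) (Fin n) ℝ} (hA : A.PosDef) {Y : symFamilies n k}
    (hY : Y ∈ posDefFamilies n k) :
    ∑ J, (Real.log (block Y J).det - (A⁻¹ * extendByZero J (block Y J)).trace) ≤
      ((n - 1).choose (k - 1) : ℝ) * (Real.log A.det - n) := by
  obtain ⟨m, rfl⟩ := hkn
  set F : KSubset (k * m) k → ℝ := fun J =>
    Real.log (block Y J).det - (A⁻¹ * extendByZero J (block Y J)).trace
  set T : ℝ := (Fintype.card (Fin k × Fin m ≃ Fin (k * m)) : ℝ)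
  set C : ℕ := (k * m - 1).choose (k - 1) with hC
  have hTpos : 0 < T := by
    have : Nonempty (Fin k × Fin m ≃ Fin (k * m)) := ⟨finProdFinEquiv⟩
    exact Nat.cast_pos.2 Fintype.card_pos
  have hm : 0 < m := Nat.pos_of_mul_pos_left hn
  -- From `n * (n-1).choose (k-1) = n.choose k * k` with `n = k * m`, cancelling `k`.
  have hcard : Fintype.card (KSubset (k * m) k) = m * C := by
    rw [Fintype.card_finset_len, Fintype.card_fin]
    have := Nat.add_one_mul_choose_eq (k * m - 1) (k - 1)
    rw [Nat.sub_add_cancel hn, Nat.sub_add_cancel hk, ← hC] at this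
    refine Nat.eq_of_mul_eq_mul_right hk ?_
    rw [← this]
    ring
  have hsum : ∑ e : Fin k × Fin m ≃ Fin (k * m), ∑ b, F (partBlock e b) ≤
      T * (Real.log A.det - (k * m : ℕ)) := by
    refine (Finset.sum_le_sum fun e _ => sum_partBlock_le hA hY e).trans ?_
    rw [Finset.sum_const, nsmul_eq_mul, Finset.card_univ]
  -- Each of the `m` block positions runs uniformly over the `m * C` subsets.
  have hcount : (m * C : ℝ) * ∑ e : Fin k × Fin m ≃ Fin (k * m), ∑ b, F (partBlock e b) =
      m * (T * ∑ J, F J) := by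
    rw [Finset.sum_comm, Finset.mul_sum]
    have := fun b => card_mul_sum_partBlock (m := m) b F
    rw [hcard] at this
    push_cast at this
    simp only [this, Finset.sum_const, Finset.card_univ, Fintype.card_fin, nsmul_eq_mul]
    rfl
  have hm' : (0 : ℝ) < m := by exact_mod_cast hm
  rw [mul_assoc] at hcount
  have h1 := mul_left_cancel₀ hm'.ne' hcount
  have h2 := mul_le_mul_of_nonneg_left hsum (Nat.cast_nonneg (α := ℝ) C)
  rw [h1] at h2
  refine le_of_mul_le_mul_left (h2.trans_eq ?_) hTpos
  ring

theorem fFW_ge (hk : 0 < k) (hn : 0 < n) (hkn : k ∣ n) {Y : symFamilies n k}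
    (hY : Y ∈ posDefFamilies n k) :
    fFW Y ≥ ((n - 1).choose (k - 1) : ℝ) * fSDP (Psi Y)
      + (n : ℝ) * ((n - 1).choose (k - 1) : ℝ) * Real.log ((n - 1).choose (k - 1) : ℝ) := by
  have hle : k ≤ n := Nat.le_of_dvd hn hkn
  have hX := posDef_Psi hk hle hY
  set C : ℝ := ((n - 1).choose (k - 1) : ℝ) with hC
  have hCpos : 0 < C := by
    rw [hC]
    exact_mod_cast Nat.choose_pos (by omega)
  -- With this scaling the traces add up to `tr (A⁻¹ X) = C * n`, which cancels the constant `-C *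
  -- n`.
  set A := C⁻¹ • Psi Y with hA
  have hApos : A.PosDef := hX.smul (inv_pos.2 hCpos)
  have h := sum_le_choose_mul hk hn hkn hApos hY
  have htr : ∑ J, (A⁻¹ * extendByZero J (block Y J)).trace = C * n := by
    have hXA : Psi Y = C • A := by rw [hA, smul_smul, mul_inv_cancel₀ hCpos.ne', one_smul]
    rw [← trace_sum, ← Finset.mul_sum, ← Psi, hXA, Matrix.mul_smul,
      nonsing_inv_mul _ ((isUnit_iff_isUnit_det _).1 hApos.isUnit), trace_smul, trace_one,
      Fintype.card_fin, smul_eq_mul]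
  have hdet : Real.log A.det = Real.log (Psi Y).det - n * Real.log C := by
    rw [hA, det_smul, Fintype.card_fin,
      Real.log_mul (pow_pos (inv_pos.2 hCpos) _).ne' hX.det_pos.ne', Real.log_pow, Real.log_inv]
    ring
  rw [Finset.sum_sub_distrib, htr, hdet] at h
  rw [fFW, fSDP]
  linarith

end Extension

end FactorWidth

theorem lemma1 (n k : ℕ) (hn : 0 < n) (hk : 2 ≤ k) (hkn : k ∣ n) :
    FactorWidth.IsSelfConcordantBarrier
        (FactorWidth.fFW : FactorWidth.symFamilies n k → ℝ)
        (interior (FactorWidth.psdFamilies n k)) ∧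
      ∀ Y ∈ interior (FactorWidth.psdFamilies n k),
        ∀ X : Matrix (Fin n) (Fin n) ℝ, X = FactorWidth.Psi Y →
          FactorWidth.fFW Y ≥
            ((n - 1).choose (k - 1) : ℝ) * FactorWidth.fSDP X
              + (n : ℝ) * ((n - 1).choose (k - 1) : ℝ)
                * Real.log ((n - 1).choose (k - 1) : ℝ) := by
  rw [FactorWidth.interior_psdFamilies]
  refine ⟨FactorWidth.isSelfConcordantBarrier_fFW, ?_⟩
  rintro Y hY _ rfl
  exact FactorWidth.fFW_ge (by omega) hn hkn hY
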